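/- **Setting.** There are $m$ clients, and compression parameters are vectors $q\in[0,q_{\max}]^m$, $q_{\max}\ge 0$. A network state lies in a finite set $\mathcal C$. A round in which the clients perform a fixed number $\tau$ of local computations, use the parameters $q$ and see the network state $c$ has duration $d(\tau,q,c)>0$. For $\varepsilon>0$ and a sequence $(q^n)_{n\ge1}$ in $[0,q_{\max}]^m$ let $r_\varepsilon=r_\varepsilon((q^n)_n)$ be the first round $r\ge 1$ at which a given learning algorithm, run with the parameters $(q^n)_n$, meets its stopping criterion for the tolerance $\varepsilon$. For a sequence $(c^n)_{n\ge 1}$ of network states the wall-clock time is $t_\varepsilon((q^n)_n,(c^n)_n)=\sum_{n=1}^{r_\varepsilon} d(\tau,q^n,c^n)$. **Assumptions.** 1. There are a norm $\|\cdot\|$ on $\mathbb R^m$ and, for every $\varepsilon>0$, a strictly increasing, continuous and bounded function $h_\varepsilon:[0,q_{\max}]\to[0,\infty)$ such that, writing $\boldsymbol h_\varepsilon(q)=(h_\varepsilon(q_j))_{j=1}^m$, for every sequence $(q^n)_n$ and every $r\ge 1$ the stopping criterion for the tolerance $\varepsilon$ holds at round $r$ if and only if $r>\frac1r\sum_{n=1}^r\|\boldsymbol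 h_\varepsilon(q^n)\|$. 2. For every sequence $(q^n)_n$ in $[0,q_{\max}]^m$ there is a polynomial $p$ with $p(0)=0$ such that $r_\varepsilon((q^n)_n)=\Theta(1/p(\varepsilon))$ as $\varepsilon\to0^+$. 3. $d(\tau,\cdot,\cdot)$ is bounded on $[0,q_{\max}]^m\times\mathcal C$, and for every $\varepsilon>0$ and $c\in\mathcal C$ the function $r\mapsto d(\tau,\boldsymbol h_\varepsilon^{-1}(r),c)$ on $\boldsymbol h_\varepsilon([0,q_{\max}]^m)$ is convex and is non-increasing in every coordinate of $r$. 4. The network states $(C^n)_{n\ge 1}$ form a stationary Markov chain on $\mathcal C$ whose transition matrix is irreducible and aperiodic, with invariant distribution $\mu$. **Claim.** There is a family $(\pi_\varepsilon)_{\varepsilon>0}$ of state-dependent stationary policies $\pi_\varepsilon:\mathcal C\to[0,q_{\max}]^m$ that is asymptotically optimal as $\varepsilon\to0$: let $T_\varepsilon^{\pi_\varepsilon}=t_\varepsilon\big((\pi_\varepsilon(C^n))_n,(C^n)_n\big)$ be the wall-clock time under $\pi_\varepsilon$, and let $T_\varepsilon^{*}=\inf_{(q^n)_n} t_\varepsilon\big((q^n)_n,(C^n)_n\big)$,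 the infimum being taken for each sample path $(C^n)_n$ over all sequences in $[0,q_{\max}]^m$, be the optimal wall-clock time of a policy that knows the whole sample path. Then, for every $\varepsilon>0$, both times are integrable and $\mathbb E[T_\varepsilon^*]>0$, and $$\lim_{\varepsilon\to0^+}\frac{\mathbb E\big[T_\varepsilon^{\pi_\varepsilon}\big]}{\mathbb E\big[T_\varepsilon^{*}\big]}=1 .$$ -/

import Mathlib

open Set Filter Topology MeasureTheory

namespace NACFL

/-- Admissible vectors of compression parameters: `m` clients, each parameter in `[0, qmax]`. -/
def paramBox (m : ℕ) (qmax : ℝ) : Set (Fin m → ℝ) :=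
  {q | ∀ j, q j ∈ Icc 0 qmax}

/-- Admissible sequences of compression vectors.
The entry with index `n` is the vector used in round `n + 1`. -/
def paramSeq (m : ℕ) (qmax : ℝ) : Set (ℕ → Fin m → ℝ) :=
  {q | ∀ n, q n ∈ paramBox m qmax}

/-- The vector function associated with the scalar function `h`: `h` applied to every entry. -/
def hVec {m : ℕ} (h : ℝ → ℝ) (q : Fin m → ℝ) : Fin m → ℝ :=
  fun j => h (q j)

/-- The inverse of `hVec h`, the inverse of `h : [0, qmax] → ℝ` being applied to every entry. -/
noncomputable def hVecInv {m : ℕ} (qmax : ℝ) (h : ℝ → ℝ) (r : Fin m → ℝ) : Fin m → ℝ :=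
  fun j => Function.invFunOn h (Icc 0 qmax) (r j)

/-- The minimum number of rounds needed to reach the tolerance `ε` with the parameters `q`.
`reached ε q r` says that the learning algorithm, run with the parameters `q`, meets the
stopping criterion for the tolerance `ε` at round `r`. -/
noncomputable def rounds {m : ℕ} (reached : ℝ → (ℕ → Fin m → ℝ) → ℕ → Prop)
    (ε : ℝ) (q : ℕ → Fin m → ℝ) : ℕ :=
  sInf {r : ℕ | 1 ≤ r ∧ reached ε q r}

/-- The wall clock time needed to reach the tolerance `ε` with the parameters `q` when the
sequence of network states is `c`; `d τ q c` is the duration of a round. -/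
noncomputable def wallClock {m : ℕ} {S : Type*}
    (reached : ℝ → (ℕ → Fin m → ℝ) → ℕ → Prop) (d : ℕ → (Fin m → ℝ) → S → ℝ) (τ : ℕ)
    (ε : ℝ) (q : ℕ → Fin m → ℝ) (c : ℕ → S) : ℝ :=
  ∑ n ∈ Finset.range (rounds reached ε q), d τ (q n) (c n)

/-- The wall clock time under the state dependent stationary policy `π`. -/
noncomputable def policyTime {m : ℕ} {S : Type*}
    (reached : ℝ → (ℕ → Fin m → ℝ) → ℕ → Prop) (d : ℕ → (Fin m → ℝ) → S → ℝ) (τ : ℕ)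
    (ε : ℝ) (π : S → Fin m → ℝ) (c : ℕ → S) : ℝ :=
  wallClock reached d τ ε (fun n => π (c n)) c

/-- The wall clock time under the policy that is optimal for the sample path `c`, the whole of
which it knows: the infimum over all admissible sequences of compression parameters. -/
noncomputable def optimalTime {m : ℕ} {S : Type*} (qmax : ℝ)
    (reached : ℝ → (ℕ → Fin m → ℝ) → ℕ → Prop) (d : ℕ → (Fin m → ℝ) → S → ℝ) (τ : ℕ)
    (ε : ℝ) (c : ℕ → S) : ℝ :=
  sInf ((fun q => wallClock reached d τ ε q c) '' paramSeq m qmax)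

/-- The stopping criterion of the learning algorithm is determined by `h` and the norm `N`:
it is met at round `r` if and only if `r > (1 / r) * ∑ N (h_ε (q^n))`, the sum being over the
first `r` rounds. -/
structure RoundsCriterion {m : ℕ} (qmax : ℝ)
    (reached : ℝ → (ℕ → Fin m → ℝ) → ℕ → Prop)
    (h : ℝ → ℝ → ℝ) (N : Seminorm ℝ (Fin m → ℝ)) : Prop where
  norm_definite : ∀ x, N x = 0 → x = 0
  h_nonneg : ∀ ε > 0, ∀ q ∈ Icc 0 qmax, 0 ≤ h ε q
  h_strictMono : ∀ ε > 0, StrictMonoOn (h ε) (Icc 0 qmax)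
  h_continuous : ∀ ε > 0, ContinuousOn (h ε) (Icc 0 qmax)
  h_bounded : ∀ ε > 0, Bornology.IsBounded (h ε '' Icc 0 qmax)
  reached_iff : ∀ ε > 0, ∀ q ∈ paramSeq m qmax, ∀ r : ℕ, 1 ≤ r →
    (reached ε q r ↔
      (r : ℝ) > (1 / (r : ℝ)) * ∑ n ∈ Finset.range r, N (hVec (h ε) (q n)))

/-- For every sequence of parameters the number of rounds is `Θ(1 / p(ε))` as `ε → 0⁺`, for some
polynomial `p` that vanishes at `0` (so that the number of rounds grows without bound). -/
def RoundsGrowth {m : ℕ} (qmax : ℝ)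
    (reached : ℝ → (ℕ → Fin m → ℝ) → ℕ → Prop) : Prop :=
  ∀ q ∈ paramSeq m qmax, ∃ p : Polynomial ℝ, p.eval 0 = 0 ∧
    (fun ε : ℝ => (rounds reached ε q : ℝ)) =Θ[𝓝[>] 0] (fun ε : ℝ => 1 / p.eval ε)

/-- The round duration is positive and bounded and, in every network state, it is a convex
function of `r = h_ε(q)` that is decreasing in every coordinate of `r`. -/
structure DurationAssumption {m : ℕ} {S : Type*} (qmax : ℝ) (h : ℝ → ℝ → ℝ)
    (d : ℕ → (Fin m → ℝ) → S → ℝ) (τ : ℕ) : Prop where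
  pos : ∀ q ∈ paramBox m qmax, ∀ c, 0 < d τ q c
  bounded : ∃ B : ℝ, ∀ q ∈ paramBox m qmax, ∀ c, d τ q c ≤ B
  convex : ∀ ε > 0, ∀ c,
    ConvexOn ℝ (hVec (h ε) '' paramBox m qmax) (fun r => d τ (hVecInv qmax (h ε) r) c)
  decreasing : ∀ ε > 0, ∀ c,
    AntitoneOn (fun r => d τ (hVecInv qmax (h ε) r) c) (hVec (h ε) '' paramBox m qmax)

/-- `C` is a stationary Markov chain on the finite set `S` with transition matrix `M` and
invariant distribution `μ`, and `M` is irreducible and aperiodic. -/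
structure IsStationaryErgodicChain {Ω : Type*} [MeasurableSpace Ω] (P : Measure Ω)
    {S : Type*} [Fintype S] [DecidableEq S] [MeasurableSpace S]
    (C : ℕ → Ω → S) (M : Matrix S S ℝ) (μ : S → ℝ) : Prop where
  measurable : ∀ n, Measurable (C n)
  stochastic : M ∈ Matrix.rowStochastic ℝ S
  distribution : μ ∈ stdSimplex ℝ S
  invariant : Matrix.vecMul μ M = μ
  law : ∀ (n : ℕ) (c : ℕ → S),
    P.real {ω | ∀ i ≤ n, C i ω = c i} =
      μ (c 0) * ∏ i ∈ Finset.range n, M (c i) (c (i + 1))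
  irreducible : M.IsIrreducible
  aperiodic : ∀ c : S, ∀ k : ℕ, (∀ n : ℕ, 1 ≤ n → 0 < (M ^ n) c c → k ∣ n) → k = 1

end NACFL

open NACFL

/-! For a policy `π` let `A` and `F` be the means under `μ` of the norm of `h_ε(π)` and of the round
duration. The criterion at round `r` says that the sum of the first `r` norms is below `r ^ 2`. By
ergodicity this sum is about `r * A`, so about `A` rounds are needed and the time is about `A * F`,
which is `policyCost`. The policy `π_ε` minimises this product up to the factor `1 + ε`.

No sequence does essentially better. On a path with typical frequencies, averaging `h_ε(q^n)` over
the visits to each state yields a stationary policy. By convexity of the norm and of the duration,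
neither the sum of norms nor the total time increases (`exists_averaged_policy`). The criterion then
forces `r ≥ (1 - δ) * A`, and the time is at least `(1 - δ) ^ 2 * A * F`
(`wallClock_ge_of_typical`). The matching bound for a policy is `policyTime_le_of_typical`.

The frequencies settle almost surely (`ae_tendsto_visits_div`), and the number of rounds tends to
infinity uniformly over all sequences (`exists_mul_apply_zero_le`, `tendsto_apply_zero_atTop`).
Hence for small `ε` only paths of probability at most `δ` are atypical. There `policyTime_le` still
bounds the time by a fixed multiple of the cost, so they contribute little to the expectation. -/

namespace NACFL

/-! ### Irreducible stochastic matrices and the Poisson equation -/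

section StochasticMatrix

variable {S : Type*} [Fintype S] [DecidableEq S] {M : Matrix S S ℝ} {μ : S → ℝ}

theorem pow_mulVec_of_harmonic {v : S → ℝ} (hv : M.mulVec v = v) (k : ℕ) :
    (M ^ k).mulVec v = v := by
  induction k with
  | zero => simp
  | succ k ih => rw [pow_succ, ← Matrix.mulVec_mulVec, hv, ih]

theorem vecMul_pow_of_invariant (hμ : Matrix.vecMul μ M = μ) (k : ℕ) :
    Matrix.vecMul μ (M ^ k) = μ := by
  induction k with
  | zero => simp
  | succ k ih => rw [pow_succ, ← Matrix.vecMul_vecMul, ih, hμ]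

/-- Harmonic functions of an irreducible stochastic matrix are constant. -/
theorem harmonic_eq (hM : M ∈ Matrix.rowStochastic ℝ S) (hirr : M.IsIrreducible) {v : S → ℝ}
    (hv : M.mulVec v = v) (i j : S) : v i = v j := by
  have : Nonempty S := ⟨i⟩
  obtain ⟨a, ha⟩ := Finite.exists_max v
  suffices H : ∀ b, v b = v a by rw [H i, H j]
  intro b
  obtain ⟨k, -, hk⟩ := (Matrix.isIrreducible_iff_exists_pow_pos hM.1).1 hirr a b
  have hP : M ^ k ∈ Matrix.rowStochastic ℝ S := pow_mem hM k
  -- Maximum principle: a weighted mean of nonnegative gaps vanishes, so the gap is zero at every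
  -- state reached from `a` in `k` steps.
  have hsum : ∑ x, (M ^ k) a x * (v a - v x) = 0 := by
    have h1 := congrFun (pow_mulVec_of_harmonic hv k) a
    simp only [Matrix.mulVec, dotProduct] at h1
    simp only [mul_sub, Finset.sum_sub_distrib, h1, ← Finset.sum_mul,
      Matrix.sum_row_of_mem_rowStochastic hP a]
    ring
  have h0 := (Finset.sum_eq_zero_iff_of_nonneg
    (fun x _ => mul_nonneg (hP.1 a x) (sub_nonneg.2 (ha x)))).1 hsum b (Finset.mem_univ b)
  rcases mul_eq_zero.1 h0 with h0 | h0
  · exact absurd h0 hk.ne'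
  · linarith

/-- The Poisson equation of an irreducible stochastic matrix. -/
theorem exists_poisson_solution (hM : M ∈ Matrix.rowStochastic ℝ S) (hirr : M.IsIrreducible)
    (hμ : μ ∈ stdSimplex ℝ S) (hinv : Matrix.vecMul μ M = μ) {f : S → ℝ}
    (hf : ∑ s, μ s * f s = 0) : ∃ g : S → ℝ, ∀ s, g s - M.mulVec g s = f s := by
  have hμM : ∀ v : S → ℝ, ∑ s, μ s * M.mulVec v s = ∑ s, μ s * v s := by
    intro v
    have := Matrix.dotProduct_mulVec μ M v
    rw [hinv] at this
    exact this
  -- The kernel of `1 - M` consists of constants; adding the mean under `μ` makes the map injective,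
  -- hence surjective. If `f` has mean zero, so has its preimage, and the added term disappears.
  let T : (S → ℝ) →ₗ[ℝ] (S → ℝ) :=
    { toFun := fun v s => v s - M.mulVec v s + ∑ t, μ t * v t
      map_add' := by
        intro v w
        funext s
        simp only [Matrix.mulVec_add, Pi.add_apply, mul_add, Finset.sum_add_distrib]
        ring
      map_smul' := by
        intro c v
        funext s
        simp only [Matrix.mulVec_smul, Pi.smul_apply, smul_eq_mul, RingHom.id_apply, mul_left_comm,
          ← Finset.mul_sum]
        ring }
  have hT : ∀ v, ∑ s, μ s * T v s = ∑ t, μ t * v t := by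
    intro v
    change ∑ s, μ s * (v s - M.mulVec v s + ∑ t, μ t * v t) = _
    simp only [mul_add, mul_sub, Finset.sum_add_distrib, Finset.sum_sub_distrib, hμM,
      ← Finset.sum_mul, hμ.2]
    ring
  have hinj : Function.Injective T := by
    rw [← LinearMap.ker_eq_bot, LinearMap.ker_eq_bot']
    intro v hv
    have hmean : ∑ t, μ t * v t = 0 := by rw [← hT v, hv]; simp
    have hharm : M.mulVec v = v := by
      funext s
      have h1 : v s - M.mulVec v s + ∑ t, μ t * v t = 0 := congrFun hv s
      rw [hmean] at h1
      linarith
    funext s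
    have : ∑ t, μ t * v t = v s := by
      rw [Finset.sum_congr rfl fun t _ => by rw [harmonic_eq hM hirr hharm t s],
        ← Finset.sum_mul, hμ.2, one_mul]
    rw [← this, hmean]
    rfl
  obtain ⟨g, hg⟩ := LinearMap.injective_iff_surjective.1 hinj f
  refine ⟨g, fun s => ?_⟩
  have h1 : g s - M.mulVec g s + ∑ t, μ t * g t = f s := congrFun hg s
  rw [← hT g, hg, hf] at h1
  linarith

theorem invariant_pos (hM : M ∈ Matrix.rowStochastic ℝ S) (hirr : M.IsIrreducible)
    (hμ : μ ∈ stdSimplex ℝ S) (hinv : Matrix.vecMul μ M = μ) (s : S) : 0 < μ s := by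
  obtain ⟨a, -, ha⟩ : ∃ a ∈ Finset.univ, 0 < μ a := by
    apply Finset.exists_lt_of_sum_lt
    simp [hμ.2]
  obtain ⟨k, -, hk⟩ := (Matrix.isIrreducible_iff_exists_pow_pos hM.1).1 hirr a s
  have hP : M ^ k ∈ Matrix.rowStochastic ℝ S := pow_mem hM k
  rw [← congrFun (vecMul_pow_of_invariant hinv k) s]
  exact (mul_pos ha hk).trans_le <| Finset.single_le_sum
    (f := fun i => μ i * (M ^ k) i s) (fun i _ => mul_nonneg (hμ.1 i) (hP.1 i s))
    (Finset.mem_univ a)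

end StochasticMatrix

/-! ### Martingale part of an additive functional -/

section Increments

variable {S : Type*} [Fintype S] {M : Matrix S S ℝ}

/-- The martingale part of the additive functional of a solution of the Poisson equation. -/
def incrementSum (M : Matrix S S ℝ) (g : S → ℝ) (n : ℕ) (c : ℕ → S) : ℝ :=
  ∑ i ∈ Finset.range n, (g (c (i + 1)) - M.mulVec g (c i))

theorem incrementSum_congr (g : S → ℝ) (n : ℕ) {c c' : ℕ → S} (hc : ∀ i < n + 1, c i = c' i) :
    incrementSum M g n c = incrementSum M g n c' := by
  refine Finset.sum_congr rfl fun i hi => ?_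
  have hi := Finset.mem_range.1 hi
  rw [hc i (by omega), hc (i + 1) (by omega)]

end Increments

/-! ### Ergodic theorem for the chain -/

section Chains

variable {Ω : Type*} [MeasurableSpace Ω] {P : Measure Ω} [IsProbabilityMeasure P]
  {S : Type*} [Fintype S] [MeasurableSpace S] [MeasurableSingletonClass S]
  {C : ℕ → Ω → S}

/-- A function of the path of a process with finitely many states is integrable if it depends on
finitely many coordinates only. -/
theorem integrable_of_dependsOn_prefix (hC : ∀ n, Measurable (C n)) (K : ℕ) (G : (ℕ → S) → ℝ)
    (hG : ∀ c c' : ℕ → S, (∀ i < K, c i = c' i) → G c = G c') :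
    Integrable (fun ω => G (fun n => C n ω)) P := by
  obtain ⟨ω₀⟩ : Nonempty Ω := nonempty_of_isProbabilityMeasure P
  let Z : Ω → (Fin K → S) := fun ω i => C i ω
  have hZ : Measurable Z := measurable_pi_lambda _ fun i => hC i
  let G' : (Fin K → S) → ℝ := fun x => G fun i => if hi : i < K then x ⟨i, hi⟩ else C 0 ω₀
  have hG' : (fun ω => G (fun n => C n ω)) = G' ∘ Z := by
    funext ω
    refine hG _ _ fun i hi => ?_
    simp [hi, Z]
  have : IsProbabilityMeasure (P.map Z) := Measure.isProbabilityMeasure_map hZ.aemeasurable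
  rw [hG']
  exact (Integrable.of_finite (μ := P.map Z) (f := G')).comp_measurable hZ

variable [DecidableEq S] {M : Matrix S S ℝ} {μ : S → ℝ}

/-- The increments `g (C (n + 1)) - (M g) (C n)` are orthogonal to the functions of the past. -/
theorem integral_mul_increment_eq_zero (hchain : IsStationaryErgodicChain P C M μ) (n : ℕ)
    (Φ : (ℕ → S) → ℝ) (hΦ : ∀ c c' : ℕ → S, (∀ i < n + 1, c i = c' i) → Φ c = Φ c')
    (g : S → ℝ) :
    ∫ ω, Φ (fun k => C k ω) * (g (C (n + 1) ω) - M.mulVec g (C n ω)) ∂P = 0 := by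
  let Z : Ω → (Fin (n + 1) → S) × S := fun ω => (fun i => C i ω, C (n + 1) ω)
  have hZ : Measurable Z :=
    (measurable_pi_lambda (fun ω (i : Fin (n + 1)) => C i ω)
      fun i => hchain.measurable i).prodMk (hchain.measurable (n + 1))
  let e : (Fin (n + 1) → S) → ℕ → S := fun x i => if hi : i < n + 1 then x ⟨i, hi⟩ else x 0
  have he : ∀ x i (hi : i < n + 1), e x i = x ⟨i, hi⟩ := fun x i hi => dif_pos hi
  let Ψ : (Fin (n + 1) → S) × S → ℝ :=
    fun x => Φ (e x.1) * (g x.2 - M.mulVec g (e x.1 n))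
  have hΨ : (fun ω => Φ (fun k => C k ω) * (g (C (n + 1) ω) - M.mulVec g (C n ω))) =
      fun ω => Ψ (Z ω) := by
    funext ω
    have h1 : Φ (fun k => C k ω) = Φ (e (Z ω).1) := hΦ _ _ fun i hi => by rw [he _ i hi]
    simp only [Ψ, ← h1]
    simp [Z, e]
  have : IsProbabilityMeasure (P.map Z) := Measure.isProbabilityMeasure_map hZ.aemeasurable
  have hlaw : ∀ x y, (P.map Z).real {(x, y)} =
      (μ (e x 0) * ∏ i ∈ Finset.range n, M (e x i) (e x (i + 1))) * M (e x n) y := by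
    intro x y
    rw [map_measureReal_apply hZ (measurableSet_singleton _)]
    let c : ℕ → S := fun i => if i < n + 1 then e x i else y
    have hc : ∀ i < n + 1, c i = e x i := fun i hi => if_pos hi
    have hc' : c (n + 1) = y := if_neg (lt_irrefl _)
    have hset : Z ⁻¹' {(x, y)} = {ω | ∀ i ≤ n + 1, C i ω = c i} := by
      ext ω
      simp only [mem_preimage, mem_singleton_iff, Prod.ext_iff, mem_ofPred_eq, Z, funext_iff]
      constructor
      · rintro ⟨h1, h2⟩ i hi
        rcases Nat.lt_or_eq_of_le hi with hi | rfl
        · rw [hc i hi, he x i hi, ← h1 ⟨i, hi⟩]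
        · rw [hc', ← h2]
      · intro h1
        refine ⟨fun i => ?_, ?_⟩
        · rw [h1 i i.2.le, hc i i.2, he x i i.2]
        · rw [h1 (n + 1) le_rfl, hc']
    rw [hset, hchain.law, Finset.prod_range_succ, ← mul_assoc]
    have hprod : ∏ i ∈ Finset.range n, M (c i) (c (i + 1)) =
        ∏ i ∈ Finset.range n, M (e x i) (e x (i + 1)) :=
      Finset.prod_congr rfl fun i hi => by
        have hi := Finset.mem_range.1 hi
        rw [hc i (by omega), hc (i + 1) (by omega)]
    rw [hprod, hc 0 (by omega), hc n (by omega), hc']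
  rw [hΨ, ← integral_map (φ := Z) (f := Ψ) hZ.aemeasurable
    (Measurable.of_discrete.aestronglyMeasurable),
    integral_fintype Integrable.of_finite, Fintype.sum_prod_type]
  -- For each fixed past `x` the sum over the next state vanishes: `M.mulVec g` is the conditional
  -- mean of `g`, and the row sums to one.
  refine Finset.sum_eq_zero fun x _ => ?_
  have hrow := Matrix.sum_row_of_mem_rowStochastic hchain.stochastic (e x n)
  set p := μ (e x 0) * ∏ i ∈ Finset.range n, M (e x i) (e x (i + 1)) with hp
  have : ∀ y, (P.map Z).real {(x, y)} • Ψ (x, y) =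
      p * Φ (e x) * (M (e x n) y * g y) - p * Φ (e x) * M.mulVec g (e x n) * M (e x n) y := by
    intro y
    rw [hlaw, smul_eq_mul]
    simp only [Ψ]
    ring
  rw [Finset.sum_congr rfl fun y _ => this y, Finset.sum_sub_distrib, ← Finset.mul_sum,
    ← Finset.mul_sum, hrow]
  simp only [Matrix.mulVec, dotProduct]
  ring

/-- Orthogonality of the increments removes the cross terms, so the second moment grows by at most a
constant per step. -/
theorem exists_integral_incrementSum_sq_le (hchain : IsStationaryErgodicChain P C M μ)
    (g : S → ℝ) :
    ∃ K : ℝ, ∀ n : ℕ, ∫ ω, incrementSum M g n (fun k => C k ω) ^ 2 ∂P ≤ K * n := by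
  obtain ⟨K, hK⟩ : ∃ K : ℝ, ∀ x : S × S, (g x.2 - M.mulVec g x.1) ^ 2 ≤ K := by
    obtain ⟨K, hK⟩ := (Set.finite_range fun x : S × S => (g x.2 - M.mulVec g x.1) ^ 2).bddAbove
    exact ⟨K, fun x => hK ⟨x, rfl⟩⟩
  refine ⟨K, fun n => ?_⟩
  induction n with
  | zero => simp [incrementSum]
  | succ n ih =>
    have h1 : Integrable (fun ω => incrementSum M g n (fun k => C k ω) ^ 2) P :=
      integrable_of_dependsOn_prefix hchain.measurable (n + 1)
        (fun c => incrementSum M g n c ^ 2)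
        fun c c' hc => by simp only [incrementSum_congr g n hc]
    have h2 : Integrable (fun ω => 2 * (incrementSum M g n (fun k => C k ω) *
        (g (C (n + 1) ω) - M.mulVec g (C n ω)))) P :=
      integrable_of_dependsOn_prefix hchain.measurable (n + 2)
        (fun c => 2 * (incrementSum M g n c * (g (c (n + 1)) - M.mulVec g (c n))))
        fun c c' hc => by
          simp only [incrementSum_congr g n fun i hi => hc i (by omega),
            hc n (by omega), hc (n + 1) (by omega)]
    have h3 : Integrable (fun ω => (g (C (n + 1) ω) - M.mulVec g (C n ω)) ^ 2) P :=
      integrable_of_dependsOn_prefix hchain.measurable (n + 2)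
        (fun c => (g (c (n + 1)) - M.mulVec g (c n)) ^ 2)
        fun c c' hc => by simp only [hc n (by omega), hc (n + 1) (by omega)]
    have h4 : (fun ω => incrementSum M g (n + 1) (fun k => C k ω) ^ 2) = fun ω =>
        incrementSum M g n (fun k => C k ω) ^ 2 + 2 * (incrementSum M g n (fun k => C k ω) *
        (g (C (n + 1) ω) - M.mulVec g (C n ω))) + (g (C (n + 1) ω) - M.mulVec g (C n ω)) ^ 2 := by
      funext ω
      simp only [incrementSum, Finset.sum_range_succ]
      ring
    have h5 : ∫ ω, (g (C (n + 1) ω) - M.mulVec g (C n ω)) ^ 2 ∂P ≤ K := by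
      calc _ ≤ ∫ _, K ∂P := integral_mono h3 (integrable_const K)
              fun ω => hK (C n ω, C (n + 1) ω)
        _ = K := by simp
    have h12 := integral_add (h1.add h2) h3
    simp only [Pi.add_apply] at h12
    rw [h4, h12, integral_add h1 h2, integral_const_mul,
      integral_mul_increment_eq_zero hchain n (incrementSum M g n)
        (fun c c' hc => incrementSum_congr g n hc)]
    push_cast
    linarith

/-- Along the squares the second moments are `O(1 / n ^ 2)`, hence summable; the series of squares
is almost surely finite and its terms tend to zero. -/
theorem ae_tendsto_incrementSum_sq_div (hchain : IsStationaryErgodicChain P C M μ)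
    (g : S → ℝ) :
    ∀ᵐ ω ∂P, Tendsto (fun n : ℕ => incrementSum M g (n ^ 2) (fun k => C k ω) / (n : ℝ) ^ 2)
      atTop (𝓝 0) := by
  obtain ⟨K, hK⟩ := exists_integral_incrementSum_sq_le hchain g
  let X : ℕ → Ω → ℝ := fun n ω => (incrementSum M g (n ^ 2) (fun k => C k ω) / (n : ℝ) ^ 2) ^ 2
  have hXi : ∀ n, Integrable (X n) P := fun n =>
    integrable_of_dependsOn_prefix hchain.measurable (n ^ 2 + 1)
      (fun c => (incrementSum M g (n ^ 2) c / (n : ℝ) ^ 2) ^ 2)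
      fun c c' hc => by simp only [incrementSum_congr g (n ^ 2) hc]
  have hX0 : ∀ n ω, 0 ≤ X n ω := fun n ω => sq_nonneg _
  have hXint : ∀ n, ∫ ω, X n ω ∂P ≤ K * (1 / (n : ℝ) ^ 2) := by
    intro n
    simp only [X, div_pow]
    rw [integral_div]
    rcases Nat.eq_zero_or_pos n with rfl | hn
    · simp
    have hn' : (0 : ℝ) < n := by exact_mod_cast hn
    rw [div_le_iff₀ (by positivity)]
    refine (hK (n ^ 2)).trans_eq ?_
    push_cast
    field_simp
  have hsum : ∑' n, ∫⁻ ω, ENNReal.ofReal (X n ω) ∂P ≠ ⊤ := by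
    have hs : Summable fun n : ℕ => K * (1 / (n : ℝ) ^ 2) :=
      (Real.summable_one_div_nat_pow.2 one_lt_two).mul_left K
    refine ne_top_of_le_ne_top hs.tsum_ofReal_ne_top (ENNReal.tsum_le_tsum fun n => ?_)
    rw [← ofReal_integral_eq_lintegral_ofReal (hXi n) (ae_of_all _ (hX0 n))]
    exact ENNReal.ofReal_le_ofReal (hXint n)
  have hmeas : ∀ n, AEMeasurable (fun ω => ENNReal.ofReal (X n ω)) P :=
    fun n => (hXi n).1.aemeasurable.ennreal_ofReal
  rw [← lintegral_tsum hmeas] at hsum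
  filter_upwards [ae_lt_top' (AEMeasurable.tsum hmeas) hsum] with ω hω
  have h1 := ENNReal.tendsto_atTop_zero_of_tsum_ne_top hω.ne
  have h2 : Tendsto (fun n => X n ω) atTop (𝓝 0) := by
    have := (ENNReal.tendsto_toReal ENNReal.zero_ne_top).comp h1
    simpa [Function.comp_def, ENNReal.toReal_ofReal (hX0 _ ω)] using this
  have h3 := (Real.continuous_sqrt.tendsto 0).comp h2
  simp only [Function.comp_def, X, Real.sqrt_sq_eq_abs, Real.sqrt_zero] at h3
  exact (tendsto_zero_iff_abs_tendsto_zero _).2 h3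

/-- The number of visits of the path `c` to the state `s` before the time `n`. -/
def visits (c : ℕ → S) (s : S) (n : ℕ) : ℝ :=
  ∑ i ∈ Finset.range n, if c i = s then 1 else 0

/-- The ergodic theorem for the frequencies of the states of an irreducible chain. -/
theorem ae_tendsto_visits_div (hchain : IsStationaryErgodicChain P C M μ) (s : S) :
    ∀ᵐ ω ∂P, Tendsto (fun n : ℕ => visits (fun k => C k ω) s n / n) atTop (𝓝 (μ s)) := by
  have hf : ∑ t, μ t * ((if t = s then 1 else 0) - μ s) = 0 := by
    simp [mul_sub, Finset.sum_sub_distrib, ← Finset.sum_mul, hchain.distribution.2]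
  obtain ⟨g, hg⟩ := exists_poisson_solution hchain.stochastic hchain.irreducible
    hchain.distribution hchain.invariant hf
  obtain ⟨B, hB⟩ : ∃ B : ℝ, ∀ x : S × S, |g x.1 - g x.2| ≤ B := by
    obtain ⟨B, hB⟩ := (Set.finite_range fun x : S × S => |g x.1 - g x.2|).bddAbove
    exact ⟨B, fun x => hB ⟨x, rfl⟩⟩
  filter_upwards [ae_tendsto_incrementSum_sq_div hchain g] with ω hω
  -- The Poisson equation splits the count into its mean, a martingale and a telescoping, bounded
  -- remainder.
  have hdecomp : ∀ n, visits (fun k => C k ω) s n =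
      n * μ s + incrementSum M g n (fun k => C k ω) + (g (C 0 ω) - g (C n ω)) := by
    intro n
    have h1 : ∀ i, (if C i ω = s then (1 : ℝ) else 0) = μ s +
        (g (C (i + 1) ω) - M.mulVec g (C i ω)) - (g (C (i + 1) ω) - g (C i ω)) := by
      intro i
      have := hg (C i ω)
      linarith
    simp only [visits, incrementSum, h1]
    rw [Finset.sum_sub_distrib, Finset.sum_add_distrib,
      Finset.sum_range_sub (fun i => g (C i ω))]
    simp
    ring
  -- Counts are monotone and consecutive squares have ratio tending to `1`, so convergence along the
  -- squares suffices.
  apply tendsto_div_of_monotone_of_exists_subseq_tendsto_div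
  · exact monotone_nat_of_le_succ fun n => by
      simp only [visits, Finset.sum_range_succ]
      split_ifs <;> simp
  · intro a ha
    refine ⟨fun n => n ^ 2, ?_, tendsto_pow_atTop two_ne_zero, ?_⟩
    · have h1 : Tendsto (fun n : ℕ => (1 + 1 / (n : ℝ)) ^ 2) atTop (𝓝 ((1 + 0) ^ 2)) :=
        (tendsto_one_div_atTop_nhds_zero_nat.const_add 1).pow 2
      rw [add_zero, one_pow] at h1
      filter_upwards [h1.eventually_lt_const ha, eventually_gt_atTop 0] with n hn hn0
      have hn0 : (0 : ℝ) < n := by exact_mod_cast hn0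
      have : ((n : ℝ) + 1) ^ 2 = (1 + 1 / (n : ℝ)) ^ 2 * (n : ℝ) ^ 2 := by
        field_simp
      push_cast
      rw [this]
      gcongr
    · have hbdd : Tendsto (fun n : ℕ => (g (C 0 ω) - g (C (n ^ 2) ω)) / (n : ℝ) ^ 2) atTop
          (𝓝 0) := by
        have hB' : Tendsto (fun n : ℕ => B / (n : ℝ) ^ 2) atTop (𝓝 0) :=
          tendsto_const_nhds.div_atTop
            ((tendsto_pow_atTop two_ne_zero).comp tendsto_natCast_atTop_atTop)
        refine squeeze_zero_norm (fun n => ?_) hB'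
        rw [norm_div, Real.norm_eq_abs, Real.norm_of_nonneg (by positivity : (0:ℝ) ≤ (n:ℝ) ^ 2)]
        gcongr
        exact hB (C 0 ω, C (n ^ 2) ω)
      have hlim := (hω.add hbdd).const_add (μ s)
      rw [add_zero, add_zero] at hlim
      refine hlim.congr' ?_
      filter_upwards [eventually_gt_atTop 0] with n hn
      have hn : (0 : ℝ) < n := by exact_mod_cast hn
      rw [hdecomp]
      push_cast
      field_simp
      ring

end Chains

/-! ### Equivalence of norms -/

section Norm

variable {m : ℕ}

/-- A definite seminorm on `ℝ^m` is equivalent to the supremum norm. -/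
theorem exists_norm_equiv {N : Seminorm ℝ (Fin m → ℝ)} (hN : ∀ x, N x = 0 → x = 0) :
    ∃ κ > 0, ∃ K > 0, ∀ x, κ * ‖x‖ ≤ N x ∧ N x ≤ K * ‖x‖ := by
  have hupper : ∀ x, N x ≤ (∑ j, N (Pi.single j 1) + 1) * ‖x‖ := by
    intro x
    calc N x = N (∑ j, x j • (Pi.single j (1 : ℝ) : Fin m → ℝ)) := by
          congr 1
          funext i
          simp [Finset.sum_apply, Pi.single_apply]
      _ ≤ ∑ j, N (x j • (Pi.single j (1 : ℝ) : Fin m → ℝ)) :=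
          Finset.le_sum_of_subadditive N (map_zero N).le (map_add_le_add N) _ _
      _ ≤ ∑ j, N (Pi.single j 1) * ‖x‖ := by
          refine Finset.sum_le_sum fun j _ => ?_
          rw [map_smul_eq_mul, mul_comm]
          exact mul_le_mul_of_nonneg_left (norm_le_pi_norm x j) (apply_nonneg N _)
      _ ≤ _ := by
          rw [← Finset.sum_mul]
          exact mul_le_mul_of_nonneg_right (by linarith) (norm_nonneg x)
  have hK : 0 < ∑ j, N (Pi.single j (1 : ℝ) : Fin m → ℝ) + 1 :=
    add_pos_of_nonneg_of_pos (Finset.sum_nonneg fun j _ => apply_nonneg N _) one_pos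
  have hcont : Continuous N := by
    refine Seminorm.continuous_of_le (q := (∑ j, N (Pi.single j (1 : ℝ) : Fin m → ℝ) + 1).toNNReal •
      normSeminorm ℝ (Fin m → ℝ)) ?_ fun x => ?_
    · exact continuous_norm.const_smul _
    · simpa [NNReal.smul_def, Real.coe_toNNReal _ hK.le] using hupper x
  suffices H : ∃ κ > 0, ∀ x, κ * ‖x‖ ≤ N x by
    obtain ⟨κ, hκ, h⟩ := H
    exact ⟨κ, hκ, _, hK, fun x => ⟨h x, hupper x⟩⟩
  -- The unit sphere is empty when `m = 0`.
  rcases (Metric.sphere (0 : Fin m → ℝ) 1).eq_empty_or_nonempty with he | hne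
  · refine ⟨1, one_pos, fun x => ?_⟩
    have hx : x = 0 := by
      by_contra hx
      have : ‖x‖⁻¹ • x ∈ Metric.sphere (0 : Fin m → ℝ) 1 := by
        simp [norm_smul, norm_ne_zero_iff.2 hx]
      simp [he] at this
    simp [hx]
  · obtain ⟨y, hy, hmin⟩ := (isCompact_sphere (0 : Fin m → ℝ) 1).exists_isMinOn hne
      hcont.continuousOn
    have hy1 : ‖y‖ = 1 := by simpa using hy
    refine ⟨N y, lt_of_le_of_ne (apply_nonneg N y) fun h0 => ?_, fun x => ?_⟩
    · rw [hN y h0.symm] at hy1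
      simp at hy1
    · rcases eq_or_ne x 0 with rfl | hx
      · simp
      have hx' : 0 < ‖x‖ := norm_pos_iff.2 hx
      have h1 : N y ≤ N (‖x‖⁻¹ • x) := hmin (by simp [norm_smul, hx'.ne'])
      rw [map_smul_eq_mul, norm_inv, norm_norm, inv_mul_eq_div, le_div_iff₀ hx'] at h1
      exact h1

end Norm

/-! ### Number of rounds -/

section Rounds

variable {m : ℕ} {qmax : ℝ} {reached : ℝ → (ℕ → Fin m → ℝ) → ℕ → Prop} {h : ℝ → ℝ → ℝ}
  {N : Seminorm ℝ (Fin m → ℝ)} {ε : ℝ} {q : ℕ → Fin m → ℝ}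

theorem zero_mem_paramBox (hqmax : 0 ≤ qmax) : (0 : Fin m → ℝ) ∈ paramBox m qmax :=
  fun _ => ⟨le_rfl, hqmax⟩

/-- `N` need not be monotone in the coordinates, but the supremum norm is. Comparing the two costs a
constant independent of `ε`. -/
theorem exists_mul_apply_zero_le (hcriterion : RoundsCriterion qmax reached h N)
    (hqmax : 0 ≤ qmax) :
    ∃ κ > 0, ∀ ε > 0, ∀ q ∈ paramBox m qmax,
      κ * N (hVec (h ε) 0) ≤ N (hVec (h ε) q) := by
  obtain ⟨κ, hκ, K, hK, hN⟩ := exists_norm_equiv hcriterion.norm_definite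
  refine ⟨κ / K, by positivity, fun ε hε q hq => ?_⟩
  have h1 : ‖(hVec (h ε) 0 : Fin m → ℝ)‖ ≤ ‖hVec (h ε) q‖ := by
    refine (pi_norm_le_iff_of_nonneg (norm_nonneg _)).2 fun j => ?_
    refine le_trans ?_ (norm_le_pi_norm _ j)
    have h0 := hcriterion.h_nonneg ε hε 0 ⟨le_rfl, hqmax⟩
    have h2 := (hcriterion.h_strictMono ε hε).monotoneOn ⟨le_rfl, hqmax⟩ (hq j) (hq j).1
    simp only [hVec, Pi.zero_apply, Real.norm_eq_abs]
    rwa [abs_of_nonneg h0, abs_of_nonneg (h0.trans h2)]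
  calc κ / K * N (hVec (h ε) 0) ≤ κ / K * (K * ‖hVec (h ε) q‖) := by
        gcongr
        exact (hN _).2.trans (by gcongr)
    _ = κ * ‖hVec (h ε) q‖ := by field_simp
    _ ≤ _ := (hN _).1

theorem exists_apply_le (hcriterion : RoundsCriterion qmax reached h N) (hε : 0 < ε) :
    ∃ U, 0 ≤ U ∧ ∀ q ∈ paramBox m qmax, N (hVec (h ε) q) ≤ U := by
  obtain ⟨κ, hκ, K, hK, hN⟩ := exists_norm_equiv hcriterion.norm_definite
  obtain ⟨B, hB⟩ := (hcriterion.h_bounded ε hε).exists_norm_le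
  refine ⟨K * max B 0, by positivity, fun q hq => (hN _).2.trans ?_⟩
  gcongr
  exact (pi_norm_le_iff_of_nonneg (le_max_right _ _)).2
    fun j => (hB _ ⟨q j, hq j, rfl⟩).trans (le_max_left _ _)

theorem reached_iff_sum_lt_sq (hcriterion : RoundsCriterion qmax reached h N) (hε : 0 < ε)
    (hq : q ∈ paramSeq m qmax) {r : ℕ} (hr : 1 ≤ r) :
    reached ε q r ↔ ∑ n ∈ Finset.range r, N (hVec (h ε) (q n)) < (r : ℝ) ^ 2 := by
  have hr' : (0 : ℝ) < r := by exact_mod_cast hr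
  rw [hcriterion.reached_iff ε hε q hq r hr, gt_iff_lt, one_div, inv_mul_lt_iff₀ hr', sq]

/-- The norms are bounded, so their sum grows at most linearly and eventually falls below `r ^ 2`.
Thus the `sInf` in `rounds` is attained and is not the default value `0`. -/
theorem rounds_mem (hcriterion : RoundsCriterion qmax reached h N) (hε : 0 < ε)
    (hq : q ∈ paramSeq m qmax) :
    1 ≤ rounds reached ε q ∧ reached ε q (rounds reached ε q) := by
  apply Nat.sInf_mem (s := {r : ℕ | 1 ≤ r ∧ reached ε q r})
  obtain ⟨U, hU0, hU⟩ := exists_apply_le hcriterion hε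
  obtain ⟨r, hr⟩ := exists_nat_gt U
  have hr0 : (0 : ℝ) < r := hU0.trans_lt hr
  have hr1 : 1 ≤ r := by exact_mod_cast hr0
  refine ⟨r, hr1, (reached_iff_sum_lt_sq hcriterion hε hq hr1).2 ?_⟩
  calc _ ≤ ∑ _n ∈ Finset.range r, U := Finset.sum_le_sum fun n _ => hU _ (hq n)
    _ = r * U := by simp
    _ < _ := by rw [sq]; gcongr

theorem sum_lt_rounds_sq (hcriterion : RoundsCriterion qmax reached h N) (hε : 0 < ε)
    (hq : q ∈ paramSeq m qmax) :
    ∑ n ∈ Finset.range (rounds reached ε q), N (hVec (h ε) (q n)) <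
      (rounds reached ε q : ℝ) ^ 2 :=
  (reached_iff_sum_lt_sq hcriterion hε hq (rounds_mem hcriterion hε hq).1).1
    (rounds_mem hcriterion hε hq).2

theorem sq_le_sum_of_lt_rounds (hcriterion : RoundsCriterion qmax reached h N) (hε : 0 < ε)
    (hq : q ∈ paramSeq m qmax) {k : ℕ} (hk : k < rounds reached ε q) :
    (k : ℝ) ^ 2 ≤ ∑ n ∈ Finset.range k, N (hVec (h ε) (q n)) := by
  rcases Nat.eq_zero_or_pos k with rfl | hk0
  · simp
  · by_contra! hlt
    exact Nat.notMem_of_lt_sInf hk ⟨hk0, (reached_iff_sum_lt_sq hcriterion hε hq hk0).2 hlt⟩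

/-- The `+ 1` arises because the criterion is known to fail only at the round before the last, `k`,
where `k ^ 2 ≤ k * U`. -/
theorem rounds_le_add_one (hcriterion : RoundsCriterion qmax reached h N) (hε : 0 < ε)
    (hq : q ∈ paramSeq m qmax) {U : ℝ} (hU : ∀ n, N (hVec (h ε) (q n)) ≤ U) :
    (rounds reached ε q : ℝ) ≤ U + 1 := by
  obtain ⟨k, hk⟩ := Nat.exists_eq_add_of_le' (rounds_mem hcriterion hε hq).1
  have h1 := sq_le_sum_of_lt_rounds hcriterion hε hq (k := k) (by omega)
  have h2 : ∑ n ∈ Finset.range k, N (hVec (h ε) (q n)) ≤ k * U := by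
    simpa using Finset.sum_le_sum fun n (_ : n ∈ Finset.range k) => hU n
  have hU0 : 0 ≤ U := (apply_nonneg N _).trans (hU 0)
  rw [hk]
  push_cast
  nlinarith [(Nat.cast_nonneg k : (0 : ℝ) ≤ k)]

theorem lt_rounds (hcriterion : RoundsCriterion qmax reached h N) (hε : 0 < ε)
    (hq : q ∈ paramSeq m qmax) {L : ℝ} (hL : ∀ n, L ≤ N (hVec (h ε) (q n))) :
    L < rounds reached ε q := by
  have h1 := sum_lt_rounds_sq hcriterion hε hq
  have hr : (0 : ℝ) < rounds reached ε q := by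
    exact_mod_cast (rounds_mem hcriterion hε hq).1
  have h2 : (rounds reached ε q : ℝ) * L ≤
      ∑ n ∈ Finset.range (rounds reached ε q), N (hVec (h ε) (q n)) := by
    simpa using Finset.sum_le_sum fun n (_ : n ∈ Finset.range (rounds reached ε q)) => hL n
  nlinarith

/-- The values of the norm blow up as the tolerance tends to `0`. -/
theorem tendsto_apply_zero_atTop (hcriterion : RoundsCriterion qmax reached h N)
    (hqmax : 0 ≤ qmax) (hgrowth : RoundsGrowth qmax reached) :
    Tendsto (fun ε => N (hVec (h ε) 0)) (𝓝[>] 0) atTop := by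
  have hq : (0 : ℕ → Fin m → ℝ) ∈ paramSeq m qmax := fun _ => zero_mem_paramBox hqmax
  obtain ⟨p, hp0, hp⟩ := hgrowth 0 hq
  -- At a zero of `p` the quotient `1 / p.eval ε` is `0` by convention, and the `Θ` bound would
  -- force zero rounds.
  have hne : ∀ᶠ ε in 𝓝[>] (0 : ℝ), p.eval ε ≠ 0 := by
    obtain ⟨c, hc⟩ := hp.1.bound
    filter_upwards [hc, self_mem_nhdsWithin] with ε h1 hε h0
    have h2 := (rounds_mem hcriterion hε hq).1
    rw [h0] at h1
    simp only [Real.norm_natCast, div_zero, norm_zero, mul_zero, Nat.cast_nonpos] at h1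
    omega
  have hlim : Tendsto (fun ε => p.eval ε) (𝓝[>] 0) (𝓝[≠] 0) := by
    refine tendsto_nhdsWithin_iff.2 ⟨?_, hne⟩
    have := p.continuous.tendsto 0
    rw [hp0] at this
    exact this.mono_left nhdsWithin_le_nhds
  have hinv : Tendsto (fun ε => ‖1 / p.eval ε‖) (𝓝[>] 0) atTop := by
    simpa [Function.comp_def] using (tendsto_norm_inv_nhdsNE_zero_atTop (α := ℝ)).comp hlim
  have hr : Tendsto (fun ε => ‖(rounds reached ε 0 : ℝ)‖) (𝓝[>] 0) atTop :=
    hp.tendsto_norm_atTop_iff.2 hinv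
  refine tendsto_atTop_mono' _ ?_ (tendsto_atTop_add_const_right _ (-1) hr)
  filter_upwards [self_mem_nhdsWithin] with ε hε
  have := rounds_le_add_one hcriterion hε hq (U := N (hVec (h ε) 0)) fun n => le_rfl
  rw [Real.norm_natCast]
  linarith

end Rounds

/-! ### Averaging over the visits to a state -/

section Visits

variable {S : Type*} [DecidableEq S]

theorem sum_range_eq_sum_visits [Fintype S] (c : ℕ → S) (f : S → ℝ) (r : ℕ) :
    ∑ n ∈ Finset.range r, f (c n) = ∑ s, visits c s r * f s := by
  simp only [visits, Finset.sum_mul]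
  rw [Finset.sum_comm]
  simp

/-- Jensen's inequality for the times at which a path is in a given state. -/
theorem visits_mul_le_sum {E : Type*} [AddCommGroup E] [Module ℝ E] {H : Set E} {φ : E → ℝ}
    (hφ : ConvexOn ℝ H φ) {p : ℕ → E} (hp : ∀ n, p n ∈ H) {c : ℕ → S} {s : S} {r : ℕ}
    (hr : 0 < visits c s r) :
    visits c s r * φ (∑ n ∈ Finset.range r, ((if c n = s then 1 else 0) / visits c s r) • p n) ≤
      ∑ n ∈ Finset.range r, if c n = s then φ (p n) else 0 := by
  have hw : ∑ n ∈ Finset.range r, (if c n = s then (1 : ℝ) else 0) / visits c s r = 1 := by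
    rw [← Finset.sum_div]
    exact div_self hr.ne'
  have h1 := hφ.map_sum_le (t := Finset.range r) (p := p)
    (w := fun n => (if c n = s then (1 : ℝ) else 0) / visits c s r)
    (fun n _ => div_nonneg (by split_ifs <;> norm_num) hr.le) hw fun n _ => hp n
  refine (mul_le_mul_of_nonneg_left h1 hr.le).trans_eq ?_
  rw [Finset.mul_sum]
  refine Finset.sum_congr rfl fun n _ => ?_
  split_ifs
  · simp [hr.ne']
  · simp

theorem visits_average_mem {E : Type*} [AddCommGroup E] [Module ℝ E] {H : Set E}
    (hH : Convex ℝ H) {p : ℕ → E} (hp : ∀ n, p n ∈ H) {c : ℕ → S} {s : S} {r : ℕ}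
    (hr : 0 < visits c s r) :
    ∑ n ∈ Finset.range r, ((if c n = s then (1 : ℝ) else 0) / visits c s r) • p n ∈ H :=
  hH.sum_mem (fun n _ => div_nonneg (by split_ifs <;> norm_num) hr.le)
    (by rw [← Finset.sum_div]; exact div_self hr.ne') fun n _ => hp n

end Visits

/-! ### Time bounds in terms of the policy cost -/

section Policies

variable {m : ℕ} {S : Type*} [Fintype S] {qmax : ℝ}
  {reached : ℝ → (ℕ → Fin m → ℝ) → ℕ → Prop} {h : ℝ → ℝ → ℝ}
  {N : Seminorm ℝ (Fin m → ℝ)} {d : ℕ → (Fin m → ℝ) → S → ℝ} {τ : ℕ} {μ : S → ℝ}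
  {ε : ℝ} {q : ℕ → Fin m → ℝ} {c : ℕ → S}

theorem hVecInv_hVec (hcriterion : RoundsCriterion qmax reached h N) (hε : 0 < ε)
    {x : Fin m → ℝ} (hx : x ∈ paramBox m qmax) : hVecInv qmax (h ε) (hVec (h ε) x) = x :=
  funext fun j => (hcriterion.h_strictMono ε hε).injOn.leftInvOn_invFunOn (hx j)

/-- The asymptotic cost of a policy: the product of the stationary mean of the norm, which is
asymptotically the number of rounds, and of the stationary mean of the round duration. -/
def policyCost (μ : S → ℝ) (N : Seminorm ℝ (Fin m → ℝ)) (η : ℝ → ℝ)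
    (δ : (Fin m → ℝ) → S → ℝ) (π : S → Fin m → ℝ) : ℝ :=
  (∑ s, μ s * N (hVec η (π s))) * ∑ s, μ s * δ (π s) s

theorem policyCost_nonneg (hμ : ∀ s, 0 < μ s) (hduration : DurationAssumption qmax h d τ)
    {π : S → Fin m → ℝ} (hπ : ∀ s, π s ∈ paramBox m qmax) :
    0 ≤ policyCost μ N (h ε) (d τ) π :=
  mul_nonneg (Finset.sum_nonneg fun s _ => mul_nonneg (hμ s).le (apply_nonneg N _))
    (Finset.sum_nonneg fun s _ => mul_nonneg (hμ s).le (hduration.pos _ (hπ s) s).le)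

/-- This bound holds on every path and serves the atypical ones. Since all weights are at least `κ`,
each value is at most its mean divided by `κ`; the factor `2` absorbs the `+ 1` of
`rounds_le_add_one`. -/
theorem policyTime_le (hcriterion : RoundsCriterion qmax reached h N)
    (hduration : DurationAssumption qmax h d τ) (hε : 0 < ε)
    {π : S → Fin m → ℝ} (hπ : ∀ s, π s ∈ paramBox m qmax) {κ : ℝ} (hκ : 0 < κ)
    (hμ : ∀ s, κ ≤ μ s) (hA : 1 ≤ ∑ s, μ s * N (hVec (h ε) (π s))) (hκ1 : κ ≤ 1) :
    policyTime reached d τ ε π c ≤ 2 / κ ^ 2 * policyCost μ N (h ε) (d τ) π := by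
  have hq : (fun n => π (c n)) ∈ paramSeq m qmax := fun n => hπ (c n)
  have hterm : ∀ f : S → ℝ, (∀ s, 0 ≤ f s) → ∀ s, f s ≤ (∑ t, μ t * f t) / κ := by
    intro f hf s
    rw [le_div_iff₀ hκ, mul_comm]
    exact (mul_le_mul_of_nonneg_right (hμ s) (hf s)).trans <|
      Finset.single_le_sum (f := fun t => μ t * f t)
        (fun t _ => mul_nonneg (hκ.le.trans (hμ t)) (hf t)) (Finset.mem_univ s)
  have hA' := hterm (fun s => N (hVec (h ε) (π s))) fun s => apply_nonneg N _
  have hF' := hterm (fun s => d τ (π s) s) fun s => (hduration.pos _ (hπ s) s).le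
  have hr := rounds_le_add_one hcriterion hε hq fun n => hA' (c n)
  unfold policyTime wallClock policyCost
  set A := ∑ s, μ s * N (hVec (h ε) (π s)) with hAdef
  set F := ∑ s, μ s * d τ (π s) s with hFdef
  have hF0 : 0 ≤ F := Finset.sum_nonneg fun s _ =>
    mul_nonneg (hκ.le.trans (hμ s)) (hduration.pos _ (hπ s) s).le
  have h1 : 1 ≤ A / κ := by rw [le_div_iff₀ hκ]; linarith
  calc _ ≤ ∑ n ∈ Finset.range (rounds reached ε fun n => π (c n)), F / κ :=
        Finset.sum_le_sum fun n _ => hF' (c n)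
    _ = (rounds reached ε fun n => π (c n)) * (F / κ) := by simp
    _ ≤ (2 * (A / κ)) * (F / κ) := by
        gcongr
        linarith
    _ = _ := by field_simp

variable [DecidableEq S]

/-- The parameters of a sequence can be averaged over the visits to every state. -/
theorem exists_averaged_policy (hcriterion : RoundsCriterion qmax reached h N)
    (hduration : DurationAssumption qmax h d τ) (hε : 0 < ε) (hq : q ∈ paramSeq m qmax)
    {r : ℕ} (hr : ∀ s, 0 < visits c s r) :
    ∃ π : S → Fin m → ℝ, (∀ s, π s ∈ paramBox m qmax) ∧
      ∑ s, visits c s r * N (hVec (h ε) (π s)) ≤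
        ∑ n ∈ Finset.range r, N (hVec (h ε) (q n)) ∧
      ∑ s, visits c s r * d τ (π s) s ≤ ∑ n ∈ Finset.range r, d τ (q n) (c n) := by
  have hp : ∀ n, hVec (h ε) (q n) ∈ hVec (h ε) '' paramBox m qmax :=
    fun n => mem_image_of_mem _ (hq n)
  have hconv : ∀ s, ConvexOn ℝ (hVec (h ε) '' paramBox m qmax)
      (fun r => d τ (hVecInv qmax (h ε) r) s) := hduration.convex ε hε
  -- The image of the box is convex, so each average of vectors `h_ε(q^n)` is itself the image of an
  -- admissible vector.
  choose π hπ hπ' using fun s => visits_average_mem (hconv s).1 hp (hr s)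
  refine ⟨π, hπ, ?_, ?_⟩
  · calc _ ≤ ∑ s, ∑ n ∈ Finset.range r, (if c n = s then N (hVec (h ε) (q n)) else 0) := by
          refine Finset.sum_le_sum fun s _ => ?_
          rw [hπ' s]
          exact visits_mul_le_sum (N.convexOn.subset (subset_univ _) (hconv s).1) hp (hr s)
      _ = _ := by
          rw [Finset.sum_comm]
          simp
  · calc _ ≤ ∑ s, ∑ n ∈ Finset.range r, (if c n = s then d τ (q n) s else 0) := by
          refine Finset.sum_le_sum fun s _ => ?_
          have h1 := visits_mul_le_sum (hconv s) hp (hr s)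
          rw [← hπ' s] at h1
          simpa only [hVecInv_hVec hcriterion hε (hπ s), hVecInv_hVec hcriterion hε (hq _)] using h1
      _ = _ := by
          rw [Finset.sum_comm]
          simp

/-- From the time `R` on, the frequencies of the states are within a factor `1 ± δ` of `μ`. -/
def TypicalFrom (μ : S → ℝ) (δ : ℝ) (R : ℕ) (c : ℕ → S) : Prop :=
  ∀ r ≥ R, ∀ s, (1 - δ) * (r * μ s) ≤ visits c s r ∧ visits c s r ≤ (1 + δ) * (r * μ s)

/-- Condition `hR` pushes the stopping round beyond `R`, where the frequencies are controlled. One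
factor `1 - δ` is lost in the number of rounds, the other in the mean duration. -/
theorem wallClock_ge_of_typical (hcriterion : RoundsCriterion qmax reached h N)
    (hduration : DurationAssumption qmax h d τ) (hμ : ∀ s, 0 < μ s) (hε : 0 < ε)
    (hq : q ∈ paramSeq m qmax) {δ : ℝ} (hδ1 : δ < 1) {R : ℕ}
    (hc : TypicalFrom μ δ R c) (hR : ∀ x ∈ paramBox m qmax, R ≤ N (hVec (h ε) x)) {V : ℝ}
    (hV : ∀ π : S → Fin m → ℝ, (∀ s, π s ∈ paramBox m qmax) →
      V ≤ policyCost μ N (h ε) (d τ) π) :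
    (1 - δ) ^ 2 * V ≤ wallClock reached d τ ε q c := by
  set r := rounds reached ε q with hr
  have hr0 : (0 : ℝ) < r := by exact_mod_cast (rounds_mem hcriterion hε hq).1
  have hRr : (R : ℝ) < r := lt_rounds hcriterion hε hq fun n => hR _ (hq n)
  have hvis := fun s => (hc r (by exact_mod_cast hRr.le) s).1
  have hδ : 0 < 1 - δ := by linarith
  have hpos : ∀ s, 0 < (1 - δ) * (r * μ s) := fun s => mul_pos hδ (mul_pos hr0 (hμ s))
  obtain ⟨π, hπ, hA, hF⟩ := exists_averaged_policy hcriterion hduration hε hq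
    fun s => (hpos s).trans_le (hvis s)
  have hscale : ∀ f : S → ℝ, (∀ s, 0 ≤ f s) →
      (1 - δ) * r * ∑ s, μ s * f s ≤ ∑ s, visits c s r * f s := by
    intro f hf
    rw [Finset.mul_sum]
    refine Finset.sum_le_sum fun s _ => ?_
    calc _ = (1 - δ) * (r * μ s) * f s := by ring
      _ ≤ _ := mul_le_mul_of_nonneg_right (hvis s) (hf s)
  have hA' := hscale (fun s => N (hVec (h ε) (π s))) fun s => apply_nonneg N _
  have hF' := hscale (fun s => d τ (π s) s) fun s => (hduration.pos _ (hπ s) s).le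
  have hsq := sum_lt_rounds_sq hcriterion hε hq
  set A := ∑ s, μ s * N (hVec (h ε) (π s)) with hAdef
  set F := ∑ s, μ s * d τ (π s) s with hFdef
  have hF0 : 0 ≤ F := Finset.sum_nonneg fun s _ =>
    mul_nonneg (hμ s).le (hduration.pos _ (hπ s) s).le
  have hAr : (1 - δ) * A ≤ r := by
    have : (1 - δ) * A * r ≤ r * r := by
      rw [← hr] at hsq
      nlinarith
    exact le_of_mul_le_mul_right this hr0
  calc (1 - δ) ^ 2 * V ≤ (1 - δ) ^ 2 * (A * F) := by
        gcongr
        exact hV π hπ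
    _ = ((1 - δ) * A) * ((1 - δ) * F) := by ring
    _ ≤ r * ((1 - δ) * F) := by gcongr
    _ = (1 - δ) * r * F := by ring
    _ ≤ _ := hF'.trans hF

theorem policyTime_le_of_typical (hcriterion : RoundsCriterion qmax reached h N)
    (hduration : DurationAssumption qmax h d τ) (hμ : μ ∈ stdSimplex ℝ S) (hε : 0 < ε)
    {π : S → Fin m → ℝ} (hπ : ∀ s, π s ∈ paramBox m qmax) {δ L : ℝ} (hδ0 : 0 < δ) {R : ℕ}
    (hc : TypicalFrom μ δ R c) (hL : ∀ x ∈ paramBox m qmax, L ≤ N (hVec (h ε) x))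
    (hLR : R + 1 ≤ L) (hLδ : 1 ≤ δ * L) :
    policyTime reached d τ ε π c ≤ (1 + 2 * δ) ^ 2 * policyCost μ N (h ε) (d τ) π := by
  have hq : (fun n => π (c n)) ∈ paramSeq m qmax := fun n => hπ (c n)
  unfold policyTime wallClock
  set r := rounds reached ε (fun n => π (c n)) with hr
  have hLr : L < r := lt_rounds hcriterion hε hq fun n => hL _ (hq n)
  obtain ⟨k, hk⟩ := Nat.exists_eq_add_of_le' (rounds_mem hcriterion hε hq).1
  rw [← hr] at hk
  have hkr : (r : ℝ) = k + 1 := by rw [hk]; push_cast; rfl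
  have hRk : R ≤ k := by
    have : (R : ℝ) < k := by linarith
    exact_mod_cast this.le
  have hscale : ∀ f : S → ℝ, (∀ s, 0 ≤ f s) → ∀ j, R ≤ j →
      ∑ n ∈ Finset.range j, f (c n) ≤ (1 + δ) * j * ∑ s, μ s * f s := by
    intro f hf j hj
    rw [sum_range_eq_sum_visits, Finset.mul_sum]
    refine Finset.sum_le_sum fun s _ => ?_
    calc _ ≤ (1 + δ) * (j * μ s) * f s := mul_le_mul_of_nonneg_right (hc j hj s).2 (hf s)
      _ = _ := by ring
  have hA' := hscale (fun s => N (hVec (h ε) (π s))) (fun s => apply_nonneg N _) k hRk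
  have hF' := hscale (fun s => d τ (π s) s) (fun s => (hduration.pos _ (hπ s) s).le) r (by omega)
  have hsq := sq_le_sum_of_lt_rounds hcriterion hε hq (k := k) (by omega)
  unfold policyCost
  set A := ∑ s, μ s * N (hVec (h ε) (π s)) with hAdef
  set F := ∑ s, μ s * d τ (π s) s with hFdef
  have hF0 : 0 ≤ F := Finset.sum_nonneg fun s _ =>
    mul_nonneg (hμ.1 s) (hduration.pos _ (hπ s) s).le
  have hAL : L ≤ A := by
    calc L = ∑ s, μ s * L := by rw [← Finset.sum_mul, hμ.2, one_mul]
      _ ≤ A := Finset.sum_le_sum fun s _ => mul_le_mul_of_nonneg_left (hL _ (hπ s)) (hμ.1 s)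
  have hkA : (k : ℝ) ≤ (1 + δ) * A := by
    have hk0 : (0 : ℝ) ≤ k := k.cast_nonneg
    rcases hk0.eq_or_lt with h0 | h0
    · rw [← h0]
      have : (0 : ℝ) ≤ R := R.cast_nonneg
      have : 0 ≤ A := by linarith
      positivity
    · nlinarith
  -- The last round adds `1 ≤ δ * L ≤ δ * A` to `k ≤ (1 + δ) * A`.
  have hrA : (r : ℝ) ≤ (1 + 2 * δ) * A := by
    have : δ * L ≤ δ * A := by gcongr
    linarith
  calc _ ≤ (1 + δ) * r * F := hF'
    _ ≤ (1 + 2 * δ) * ((1 + 2 * δ) * A) * F := by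
        gcongr
        linarith
    _ = _ := by ring

end Policies

/-! ### Optimal time, integrability and typical paths -/

section Optimality

variable {m : ℕ} {S : Type*} {qmax : ℝ}
  {reached : ℝ → (ℕ → Fin m → ℝ) → ℕ → Prop} {h : ℝ → ℝ → ℝ}
  {N : Seminorm ℝ (Fin m → ℝ)} {d : ℕ → (Fin m → ℝ) → S → ℝ} {τ : ℕ} {ε : ℝ}

theorem rounds_congr (hcriterion : RoundsCriterion qmax reached h N) (hε : 0 < ε) {K : ℕ}
    (hK : ∀ q ∈ paramSeq m qmax, rounds reached ε q ≤ K) {q q' : ℕ → Fin m → ℝ}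
    (hq : q ∈ paramSeq m qmax) (hq' : q' ∈ paramSeq m qmax) (hqq' : ∀ n < K, q n = q' n) :
    rounds reached ε q = rounds reached ε q' := by
  have key : ∀ q ∈ paramSeq m qmax, ∀ q' ∈ paramSeq m qmax, (∀ n < K, q n = q' n) →
      rounds reached ε q' ≤ rounds reached ε q := by
    intro q hq q' hq' hqq'
    have h1 := rounds_mem hcriterion hε hq
    refine Nat.sInf_le ⟨h1.1, (reached_iff_sum_lt_sq hcriterion hε hq' h1.1).2 ?_⟩
    refine lt_of_eq_of_lt (Finset.sum_congr rfl fun n hn => ?_) (sum_lt_rounds_sq hcriterion hε hq)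
    rw [hqq' n ((Finset.mem_range.1 hn).trans_le (hK q hq))]
  exact le_antisymm (key q' hq' q hq fun n hn => (hqq' n hn).symm) (key q hq q' hq' hqq')

theorem exists_rounds_le (hcriterion : RoundsCriterion qmax reached h N) (hε : 0 < ε) :
    ∃ K : ℕ, ∀ q ∈ paramSeq m qmax, rounds reached ε q ≤ K := by
  obtain ⟨U, -, hU⟩ := exists_apply_le hcriterion hε
  obtain ⟨K, hK⟩ := exists_nat_ge (U + 1)
  exact ⟨K, fun q hq => by
    exact_mod_cast (rounds_le_add_one hcriterion hε hq fun n => hU _ (hq n)).trans hK⟩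

theorem wallClock_nonneg (hduration : DurationAssumption qmax h d τ) {q : ℕ → Fin m → ℝ}
    (hq : q ∈ paramSeq m qmax) (c : ℕ → S) : 0 ≤ wallClock reached d τ ε q c :=
  Finset.sum_nonneg fun n _ => (hduration.pos _ (hq n) _).le

theorem optimalTime_le_policyTime (hduration : DurationAssumption qmax h d τ)
    {π : S → Fin m → ℝ} (hπ : ∀ s, π s ∈ paramBox m qmax) (c : ℕ → S) :
    optimalTime qmax reached d τ ε c ≤ policyTime reached d τ ε π c := by
  refine csInf_le ⟨0, ?_⟩ ⟨fun n => π (c n), fun n => hπ (c n), rfl⟩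
  rintro _ ⟨q, hq, rfl⟩
  exact wallClock_nonneg hduration hq c

theorem le_optimalTime (hqmax : 0 ≤ qmax) {c : ℕ → S} {a : ℝ}
    (ha : ∀ q ∈ paramSeq m qmax, a ≤ wallClock reached d τ ε q c) :
    a ≤ optimalTime qmax reached d τ ε c := by
  refine le_csInf (Set.Nonempty.image _ ⟨0, fun _ => zero_mem_paramBox hqmax⟩) ?_
  rintro _ ⟨q, hq, rfl⟩
  exact ha q hq

/-- The duration is smallest at the corner `qmax` of the box, and there are finitely many states.
The tolerance `1` in the proof is arbitrary, as `d` does not depend on it. -/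
theorem exists_pos_le_duration [Finite S] (hcriterion : RoundsCriterion qmax reached h N)
    (hduration : DurationAssumption qmax h d τ) (hqmax : 0 ≤ qmax) :
    ∃ a > 0, ∀ q ∈ paramBox m qmax, ∀ s, a ≤ d τ q s := by
  have htop : (fun _ => qmax : Fin m → ℝ) ∈ paramBox m qmax := fun _ => ⟨hqmax, le_rfl⟩
  have hmono : ∀ q ∈ paramBox m qmax, ∀ s, d τ (fun _ => qmax) s ≤ d τ q s := by
    intro q hq s
    have h1 := hduration.decreasing 1 one_pos s (mem_image_of_mem _ hq)
      (mem_image_of_mem _ htop) fun j =>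
        (hcriterion.h_strictMono 1 one_pos).monotoneOn (hq j) ⟨hqmax, le_rfl⟩ (hq j).2
    simpa only [hVecInv_hVec hcriterion one_pos hq, hVecInv_hVec hcriterion one_pos htop] using h1
  rcases isEmpty_or_nonempty S with _ | _
  · exact ⟨1, one_pos, fun _ _ s => isEmptyElim s⟩
  · obtain ⟨s₀, hs₀⟩ := Finite.exists_min fun s => d τ (fun _ => qmax) s
    exact ⟨_, hduration.pos _ htop s₀, fun q hq s => (hs₀ s).trans (hmono q hq s)⟩

theorem le_wallClock (hcriterion : RoundsCriterion qmax reached h N)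
    (hduration : DurationAssumption qmax h d τ) (hε : 0 < ε) {a : ℝ}
    (ha : ∀ q ∈ paramBox m qmax, ∀ s, a ≤ d τ q s) {q : ℕ → Fin m → ℝ}
    (hq : q ∈ paramSeq m qmax) (c : ℕ → S) : a ≤ wallClock reached d τ ε q c :=
  (ha _ (hq 0) (c 0)).trans <| Finset.single_le_sum (f := fun n => d τ (q n) (c n))
    (fun n _ => (hduration.pos _ (hq n) _).le)
    (Finset.mem_range.2 (rounds_mem hcriterion hε hq).1)

/-- A near-minimiser is enough, so no continuity of the cost is needed; positivity of the infimum
permits a multiplicative error. -/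
theorem exists_le_one_add_mul {X : Type*} {s : Set X} (hs : s.Nonempty) {f : X → ℝ} {a : ℝ}
    (ha : 0 < a) (haf : ∀ x ∈ s, a ≤ f x) (hε : 0 < ε) :
    ∃ x ∈ s, ∀ y ∈ s, f x ≤ (1 + ε) * f y := by
  have hbdd : BddBelow (f '' s) := ⟨a, by rintro _ ⟨x, hx, rfl⟩; exact haf x hx⟩
  have hpos : a ≤ sInf (f '' s) :=
    le_csInf (hs.image f) (by rintro _ ⟨x, hx, rfl⟩; exact haf x hx)
  obtain ⟨_, ⟨x, hx, rfl⟩, hlt⟩ := exists_lt_of_csInf_lt (hs.image f)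
    (show sInf (f '' s) < (1 + ε) * sInf (f '' s) by nlinarith)
  refine ⟨x, hx, fun y hy => hlt.le.trans ?_⟩
  exact mul_le_mul_of_nonneg_left (csInf_le hbdd ⟨y, hy, rfl⟩) (by linarith)

variable [Fintype S]

theorem le_policyCost {μ : S → ℝ} (hμ : μ ∈ stdSimplex ℝ S) {L a : ℝ} (hL0 : 0 ≤ L)
    (hL : ∀ x ∈ paramBox m qmax, L ≤ N (hVec (h ε) x)) (ha0 : 0 ≤ a)
    (ha : ∀ q ∈ paramBox m qmax, ∀ s, a ≤ d τ q s) {π : S → Fin m → ℝ}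
    (hπ : ∀ s, π s ∈ paramBox m qmax) : L * a ≤ policyCost μ N (h ε) (d τ) π := by
  have hmean : ∀ (b : ℝ) (f : S → ℝ), (∀ s, b ≤ f s) → b ≤ ∑ s, μ s * f s := by
    intro b f hf
    calc b = ∑ s, μ s * b := by rw [← Finset.sum_mul, hμ.2, one_mul]
      _ ≤ _ := Finset.sum_le_sum fun s _ => mul_le_mul_of_nonneg_left (hf s) (hμ.1 s)
  exact mul_le_mul (hmean L _ fun s => hL _ (hπ s)) (hmean a _ fun s => ha _ (hπ s) s) ha0
    (hL0.trans (hmean L _ fun s => hL _ (hπ s)))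

variable {Ω : Type*} [MeasurableSpace Ω] {P : Measure Ω} [IsProbabilityMeasure P]
  [MeasurableSpace S] [MeasurableSingletonClass S] {C : ℕ → Ω → S}

theorem integrable_policyTime (hcriterion : RoundsCriterion qmax reached h N) (hε : 0 < ε)
    (hC : ∀ n, Measurable (C n)) {π : S → Fin m → ℝ} (hπ : ∀ s, π s ∈ paramBox m qmax) :
    Integrable (fun ω => policyTime reached d τ ε π (fun n => C n ω)) P := by
  obtain ⟨K, hK⟩ := exists_rounds_le hcriterion hε
  refine integrable_of_dependsOn_prefix hC K (policyTime reached d τ ε π) fun c c' hc => ?_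
  have hq : ∀ c : ℕ → S, (fun n => π (c n)) ∈ paramSeq m qmax := fun c n => hπ (c n)
  unfold policyTime wallClock
  rw [rounds_congr hcriterion hε hK (hq c) (hq c') fun n hn => by rw [hc n hn]]
  refine Finset.sum_congr rfl fun n hn => ?_
  simp only [hc n ((Finset.mem_range.1 hn).trans_le (hK _ (hq c')))]

/-- The uniform bound on the rounds lets the infimum over uncountably many sequences depend on
finitely many states only, which settles measurability. -/
theorem integrable_optimalTime (hcriterion : RoundsCriterion qmax reached h N) (hε : 0 < ε)
    (hC : ∀ n, Measurable (C n)) :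
    Integrable (fun ω => optimalTime qmax reached d τ ε (fun n => C n ω)) P := by
  obtain ⟨K, hK⟩ := exists_rounds_le hcriterion hε
  refine integrable_of_dependsOn_prefix hC K (optimalTime qmax reached d τ ε) fun c c' hc => ?_
  unfold optimalTime wallClock
  congr 1
  refine image_congr fun q hq => Finset.sum_congr rfl fun n hn => ?_
  rw [hc n ((Finset.mem_range.1 hn).trans_le (hK q hq))]

variable [DecidableEq S] {M : Matrix S S ℝ} {μ : S → ℝ}

theorem measurableSet_typicalFrom (hC : ∀ n, Measurable (C n)) (δ : ℝ) (R : ℕ) :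
    MeasurableSet {ω | TypicalFrom μ δ R (fun k => C k ω)} := by
  have hvis : ∀ s r, Measurable fun ω => visits (fun k => C k ω) s r := fun s r =>
    Finset.measurable_sum _ fun n _ =>
      Measurable.ite (hC n (measurableSet_singleton s)) measurable_const measurable_const
  have : {ω | TypicalFrom μ δ R (fun k => C k ω)} = ⋂ r, ⋂ (_ : r ≥ R), ⋂ s,
      {ω | (1 - δ) * (r * μ s) ≤ visits (fun k => C k ω) s r} ∩
        {ω | visits (fun k => C k ω) s r ≤ (1 + δ) * (r * μ s)} := by
    ext ω
    simp [TypicalFrom]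
  rw [this]
  exact MeasurableSet.iInter fun r => MeasurableSet.iInter fun _ => MeasurableSet.iInter fun s =>
    (measurableSet_le measurable_const (hvis s r)).inter
      (measurableSet_le (hvis s r) measurable_const)

theorem exists_typicalFrom_prob_ge (hchain : IsStationaryErgodicChain P C M μ) {δ : ℝ}
    (hδ : 0 < δ) : ∃ R : ℕ, 1 - δ ≤ P.real {ω | TypicalFrom μ δ R (fun k => C k ω)} := by
  have hμ := invariant_pos hchain.stochastic hchain.irreducible hchain.distribution
    hchain.invariant
  have hmono : Monotone fun R => {ω | TypicalFrom μ δ R (fun k => C k ω)} :=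
    fun R R' hR ω hω r hr s => hω r (hR.trans hr) s
  have hae : ∀ᵐ ω ∂P, ω ∈ ⋃ R, {ω | TypicalFrom μ δ R (fun k => C k ω)} := by
    filter_upwards [ae_all_iff.2 fun s => ae_tendsto_visits_div hchain s] with ω hω
    have hev : ∀ᶠ r : ℕ in atTop, ∀ s,
        (1 - δ) * (r * μ s) ≤ visits (fun k => C k ω) s r ∧
          visits (fun k => C k ω) s r ≤ (1 + δ) * (r * μ s) := by
      refine eventually_all.2 fun s => ?_
      have hs := mul_pos hδ (hμ s)
      filter_upwards [(hω s).eventually_const_le (show (1 - δ) * μ s < μ s by linarith),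
        (hω s).eventually_le_const (show μ s < (1 + δ) * μ s by linarith),
        eventually_gt_atTop 0] with r h1 h2 hr
      have hr : (0 : ℝ) < r := by exact_mod_cast hr
      rw [le_div_iff₀ hr] at h1
      rw [div_le_iff₀ hr] at h2
      exact ⟨by linarith, by linarith⟩
    obtain ⟨R, hR⟩ := eventually_atTop.1 hev
    exact mem_iUnion.2 ⟨R, hR⟩
  have hlim := tendsto_measure_iUnion_atTop (μ := P) hmono
  have hone : P (⋃ R, {ω | TypicalFrom μ δ R (fun k => C k ω)}) = 1 :=
    (measure_congr (eventuallyEq_univ.2 hae)).trans measure_univ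
  rw [hone] at hlim
  have hlim' := (ENNReal.tendsto_toReal ENNReal.one_ne_top).comp hlim
  obtain ⟨R, hR⟩ := (hlim'.eventually_const_le
    (show 1 - δ < ENNReal.toReal 1 by simpa using hδ)).exists
  exact ⟨R, hR⟩

end Optimality

end NACFL

/-! ### Asymptotic optimality -/

open NACFL
theorem lemma1
    {Ω : Type*} [MeasurableSpace Ω] (P : Measure Ω) [IsProbabilityMeasure P]
    {S : Type*} [Fintype S] [DecidableEq S] [MeasurableSpace S] [MeasurableSingletonClass S]
    (C : ℕ → Ω → S) (M : Matrix S S ℝ) (μ : S → ℝ)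
    {m : ℕ} (qmax : ℝ) (hqmax : 0 ≤ qmax)
    (reached : ℝ → (ℕ → Fin m → ℝ) → ℕ → Prop)
    (h : ℝ → ℝ → ℝ) (N : Seminorm ℝ (Fin m → ℝ))
    (d : ℕ → (Fin m → ℝ) → S → ℝ) (τ : ℕ)
    (hcriterion : RoundsCriterion qmax reached h N)
    (hgrowth : RoundsGrowth qmax reached)
    (hduration : DurationAssumption qmax h d τ)
    (hchain : IsStationaryErgodicChain P C M μ) :
    ∃ π : ℝ → S → Fin m → ℝ,
      (∀ ε > 0, ∀ c, π ε c ∈ paramBox m qmax) ∧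
      (∀ ε > 0, Integrable (fun ω => policyTime reached d τ ε (π ε) (fun n => C n ω)) P) ∧
      (∀ ε > 0, Integrable (fun ω => optimalTime qmax reached d τ ε (fun n => C n ω)) P) ∧
      (∀ ε > 0, 0 < ∫ ω, optimalTime qmax reached d τ ε (fun n => C n ω) ∂P) ∧
      Tendsto
        (fun ε : ℝ =>
          (∫ ω, policyTime reached d τ ε (π ε) (fun n => C n ω) ∂P) /
            (∫ ω, optimalTime qmax reached d τ ε (fun n => C n ω) ∂P))
        (𝓝[>] 0) (𝓝 1) := by
  have hμ := invariant_pos hchain.stochastic hchain.irreducible hchain.distribution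
    hchain.invariant
  obtain ⟨ω₀⟩ : Nonempty Ω := nonempty_of_isProbabilityMeasure P
  have hS : Nonempty S := ⟨C 0 ω₀⟩
  obtain ⟨s₀, hs₀⟩ := Finite.exists_min μ
  have hμ1 : μ s₀ ≤ 1 := hchain.distribution.2 ▸
    Finset.single_le_sum (fun s _ => (hμ s).le) (Finset.mem_univ s₀)
  obtain ⟨κ, hκ, hκN⟩ := exists_mul_apply_zero_le hcriterion hqmax
  obtain ⟨a, ha0, ha⟩ := exists_pos_le_duration hcriterion hduration hqmax
  -- The slack `1 + ε` disappears in the limit. If the lower bound on the norms is not positive, any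
  -- policy will do, since this does not happen for small `ε`.
  have hexists : ∀ ε : ℝ, ∃ π : S → Fin m → ℝ, (∀ s, π s ∈ paramBox m qmax) ∧
      (0 < ε → 0 < κ * N (hVec (h ε) 0) → ∀ π' : S → Fin m → ℝ,
        (∀ s, π' s ∈ paramBox m qmax) →
          policyCost μ N (h ε) (d τ) π ≤ (1 + ε) * policyCost μ N (h ε) (d τ) π') := by
    intro ε
    have hzero : (0 : S → Fin m → ℝ) ∈ {π : S → Fin m → ℝ | ∀ s, π s ∈ paramBox m qmax} :=
      fun _ => zero_mem_paramBox hqmax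
    by_cases hpos : 0 < ε ∧ 0 < κ * N (hVec (h ε) 0)
    · obtain ⟨π, hπ, hmin⟩ := exists_le_one_add_mul (f := policyCost μ N (h ε) (d τ)) ⟨0, hzero⟩
        (mul_pos hpos.2 ha0) (fun π hπ => le_policyCost hchain.distribution hpos.2.le
          (hκN ε hpos.1) ha0.le ha hπ) hpos.1
      exact ⟨π, hπ, fun _ _ => hmin⟩
    · exact ⟨0, hzero, fun h1 h2 => absurd ⟨h1, h2⟩ hpos⟩
  choose π hπ hmin using hexists
  have hint : ∀ ε > 0, Integrable (fun ω => policyTime reached d τ ε (π ε) (fun n => C n ω)) P :=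
    fun ε hε => integrable_policyTime hcriterion hε hchain.measurable (hπ ε)
  have hint' : ∀ ε > 0, Integrable (fun ω => optimalTime qmax reached d τ ε (fun n => C n ω)) P :=
    fun ε hε => integrable_optimalTime hcriterion hε hchain.measurable
  have hpos : ∀ ε > 0, 0 < ∫ ω, optimalTime qmax reached d τ ε (fun n => C n ω) ∂P := by
    intro ε hε
    refine ha0.trans_le ?_
    have h1 := integral_mono (integrable_const a) (hint' ε hε) fun ω =>
      le_optimalTime hqmax fun q hq => le_wallClock hcriterion hduration hε ha hq _
    simpa using h1
  refine ⟨π, fun ε _ => hπ ε, hint, hint', hpos, ?_⟩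
  refine tendsto_order.2 ⟨fun b hb => ?_, fun b hb => ?_⟩
  · filter_upwards [self_mem_nhdsWithin] with ε hε
    refine hb.trans_le ((one_le_div (hpos ε hε)).2 ?_)
    exact integral_mono (hint' ε hε) (hint ε hε) fun ω =>
      optimalTime_le_policyTime hduration (hπ ε) _
  set K := 2 / μ s₀ ^ 2 with hK
  have hK0 : 0 < K := by have := hμ s₀; positivity
  -- The quotient of the upper and lower bounds obtained below; at `δ = 0` it equals `1 < b`.
  obtain ⟨δ, hδ0, hδ1, hδb⟩ : ∃ δ : ℝ, 0 < δ ∧ δ < 1 ∧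
      (1 + δ) * ((1 + 2 * δ) ^ 2 + K * δ) / (1 - δ) ^ 3 < b := by
    have hcont : ContinuousAt
        (fun δ : ℝ => (1 + δ) * ((1 + 2 * δ) ^ 2 + K * δ) / (1 - δ) ^ 3) 0 :=
      ContinuousAt.div (by fun_prop) (by fun_prop) (by norm_num)
    have hlt := hcont.tendsto.eventually_lt_const (u := b) (by simpa using hb)
    have hev : ∀ᶠ δ in 𝓝[>] (0 : ℝ), 0 < δ ∧ δ < 1 ∧
        (1 + δ) * ((1 + 2 * δ) ^ 2 + K * δ) / (1 - δ) ^ 3 < b := by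
      filter_upwards [self_mem_nhdsWithin, nhdsWithin_le_nhds (eventually_lt_nhds one_pos),
        nhdsWithin_le_nhds hlt] with δ h1 h2 h3 using ⟨h1, h2, h3⟩
    exact hev.exists
  obtain ⟨R, hR⟩ := exists_typicalFrom_prob_ge hchain hδ0
  have hG := measurableSet_typicalFrom (μ := μ) hchain.measurable δ R
  set G := {ω | TypicalFrom μ δ R (fun k => C k ω)} with hGdef
  have hL : Tendsto (fun ε => κ * N (hVec (h ε) 0)) (𝓝[>] 0) atTop :=
    (tendsto_apply_zero_atTop hcriterion hqmax hgrowth).const_mul_atTop hκ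
  filter_upwards [self_mem_nhdsWithin, nhdsWithin_le_nhds (eventually_lt_nhds hδ0),
    hL.eventually_ge_atTop (R + 1 : ℝ), hL.eventually_ge_atTop (1 / δ)] with ε hε hεδ hLR hLδ
  have hε : 0 < ε := hε
  have hLN := hκN ε hε
  set L := κ * N (hVec (h ε) 0) with hLdef
  have hR0 : (0 : ℝ) ≤ R := R.cast_nonneg
  have hL1 : 1 ≤ L := by linarith
  rw [div_le_iff₀' hδ0] at hLδ
  refine lt_of_le_of_lt ?_ hδb
  set V := policyCost μ N (h ε) (d τ) (π ε) with hV
  have hV0 : 0 ≤ V := policyCost_nonneg hμ hduration (hπ ε)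
  -- Atypical paths are bounded below by zero; the last factor is a lower bound for the probability
  -- of `G`.
  have hlower : (1 - δ) ^ 2 * (V / (1 + δ)) * (1 - δ) ≤
      ∫ ω, optimalTime qmax reached d τ ε (fun n => C n ω) ∂P := by
    have hVmin : ∀ π' : S → Fin m → ℝ, (∀ s, π' s ∈ paramBox m qmax) →
        V / (1 + δ) ≤ policyCost μ N (h ε) (d τ) π' := by
      intro π' hπ'
      rw [div_le_iff₀' (by linarith)]
      refine (hmin ε hε (by linarith) π' hπ').trans ?_
      exact mul_le_mul_of_nonneg_right (by linarith) (policyCost_nonneg hμ hduration hπ')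
    have h1 : ∫ ω, G.indicator (fun _ => (1 - δ) ^ 2 * (V / (1 + δ))) ω ∂P ≤
        ∫ ω, optimalTime qmax reached d τ ε (fun n => C n ω) ∂P := by
      refine integral_mono ((integrable_const _).indicator hG) (hint' ε hε) fun ω => ?_
      refine le_optimalTime hqmax fun q hq => ?_
      by_cases hω : ω ∈ G
      · rw [indicator_of_mem hω]
        exact wallClock_ge_of_typical hcriterion hduration hμ hε hq hδ1 hω
          (fun x hx => le_trans (by linarith) (hLN x hx)) hVmin
      · rw [indicator_of_notMem hω]
        exact wallClock_nonneg hduration hq _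
    rw [integral_indicator_const _ hG, smul_eq_mul, mul_comm] at h1
    refine le_trans ?_ h1
    gcongr
  have hupper : ∫ ω, policyTime reached d τ ε (π ε) (fun n => C n ω) ∂P ≤
      ((1 + 2 * δ) ^ 2 + K * δ) * V := by
    have hcompl : P.real Gᶜ ≤ δ := by
      rw [probReal_compl_eq_one_sub hG]
      linarith
    have hmean : 1 ≤ ∑ s, μ s * N (hVec (h ε) (π ε s)) := by
      calc (1 : ℝ) = ∑ s, μ s * 1 := by simp [hchain.distribution.2]
        _ ≤ _ := Finset.sum_le_sum fun s _ =>
          mul_le_mul_of_nonneg_left (hL1.trans (hLN _ (hπ ε s))) (hμ s).le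
    have hi : Integrable (Gᶜ.indicator fun _ => K * V) P :=
      (integrable_const _).indicator hG.compl
    have h1 : ∫ ω, policyTime reached d τ ε (π ε) (fun n => C n ω) ∂P ≤
        ∫ ω, ((1 + 2 * δ) ^ 2 * V + Gᶜ.indicator (fun _ => K * V) ω) ∂P := by
      refine integral_mono (hint ε hε) ((integrable_const _).add hi) fun ω => ?_
      by_cases hω : ω ∈ G
      · simp only [indicator_of_notMem (notMem_compl_iff.2 hω), add_zero]
        exact policyTime_le_of_typical hcriterion hduration hchain.distribution hε (hπ ε) hδ0 hω
          hLN hLR hLδ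
      · simp only [indicator_of_mem (mem_compl hω)]
        refine (policyTime_le hcriterion hduration hε (hπ ε) (hμ s₀) hs₀ hmean hμ1).trans ?_
        exact le_add_of_nonneg_left (by positivity)
    rw [integral_add (integrable_const _) hi, integral_indicator_const _ hG.compl] at h1
    simp only [integral_const, probReal_univ, smul_eq_mul] at h1
    have : P.real Gᶜ * (K * V) ≤ δ * (K * V) := by gcongr
    linarith
  rw [div_le_iff₀ (hpos ε hε)]
  have hδ1' : 0 < 1 - δ := by linarith
  calc _ ≤ ((1 + 2 * δ) ^ 2 + K * δ) * V := hupper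
    _ = (1 + δ) * ((1 + 2 * δ) ^ 2 + K * δ) / (1 - δ) ^ 3 *
        ((1 - δ) ^ 2 * (V / (1 + δ)) * (1 - δ)) := by field_simp
    _ ≤ _ := by gcongr
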